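/- Let $\Bbbk$ be a field, let $n \ge 1$ and $\ell \ge 1$ be integers, and let $m_0,\dots,m_{n-1}$ be positive integers; indices of vertices and of the $m_i$ are read modulo $n$. Let $Q$ be the $n$-cycle quiver with vertices $0,\dots,n-1$ and exactly one arrow $\alpha_i\colon i\to i+1$ for each $i$, with paths read from left to right. Let $R$ be the arrow ideal of the path algebra $\Bbbk Q$, and put $B = B_{n,\ell} = \Bbbk Q/R^\ell$. Let $e_i$ be the trivial path at $i$, let $P_i = e_iB$ (a right $B$-module), and let $\alpha_{i,j}=\alpha_i\alpha_{i+1}\cdots\alpha_{i+j-1}$ be the path of length $j$ starting at $i$ (so $\alpha_{i,0}=e_i$). Let $$A = B_{n,\ell}(m_0,\dots,m_{n-1}) = \mathrm{End}_B\Big(\bigoplus_{i=0}^{n-1} P_i^{\oplus m_i}\Big),$$ with composition as product, and write $P_i^{r}$, $0\le r\le m_i-1$, for the copies of $P_i$. For $i$ modulo $n$, $0\le j\le \ell-1$, $0\le r\le m_i-1$ and $0\le s\le m_{i+j}-1$, let $X_{i,j}^{r,s}\in A$ be the endomorphism that maps $P_{i+j}^{s}$ to $P_i^{r}$ by left multiplication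 by $\alpha_{i,j}$ and is zero on all other summands. A $\Bbbk$-linear map $\Delta\colon A\to A\otimes A$ makes $A$ *non-counital Frobenius* if it is coassociative and a map of $A$-bimodules, where $A$ acts on $A\otimes A$ by left multiplication on the first and right multiplication on the second factor. A counit of $\Delta$ is a $\Bbbk$-linear map $\varepsilon\colon A\to\Bbbk$ with $(\varepsilon\otimes\mathrm{id})\Delta=\mathrm{id}=(\mathrm{id}\otimes\varepsilon)\Delta$. The algebra $A$ is *Frobenius* if some $\Delta$ makes it non-counital Frobenius and has a counit. Then the elements $X_{i,j}^{r,s}$ form a $\Bbbk$-basis of $A$, and the following hold for the $\Bbbk$-linear map $\Delta\colon A\to A\otimes A$ given on this basis by $$\Delta(X_{i,j}^{r,s}) = \sum_{p=0}^{\ell-1-j}\ \sum_{t=0}^{m_{i+j+p}-1}\ \sum_{u=0}^{m_{i+j+p-\ell+1}-1}\Big(1-\delta_{m_{i+j+p},\,m_{i+j+p-\ell+1}}(1-\delta_{t,u})\Big)\; X_{i,j+p}^{r,t}\otimes X_{i+j+p-\ell+1,\ \ell-1-p}^{u,s}.$$ (a) $\Delta$ makes $A$ non-counital Frobenius. (b)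 $A$ is Frobenius if and only if $m_i=m_{i-\ell+1}$ for all $i$; likewise, this particular $\Delta$ has a counit if and only if $m_i=m_{i-\ell+1}$ for all $i$. In that case the counit of $\Delta$ is given by $\varepsilon(X_{i,j}^{r,s})=\delta_{j,\ell-1}\,\delta_{r,s}$. -/

import Mathlib

open scoped TensorProduct

noncomputable section

/-! ## Path algebras of quivers with finitely many vertices -/

/-- All paths of a quiver, of all lengths (including the trivial ones). -/
abbrev QuiverPath (V : Type*) [Quiver V] := Σ a b : V, Quiver.Path a b

/-- The underlying vector space of the path algebra: it has the set of all paths as basis. -/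
def PathAlgebra (k V : Type*) [Field k] [Quiver V] := QuiverPath V →₀ k

namespace PathAlgebra

variable (k : Type*) {V : Type*} [Field k] [Quiver V]

instance : AddCommGroup (PathAlgebra k V) := inferInstanceAs (AddCommGroup (QuiverPath V →₀ k))
instance : Module k (PathAlgebra k V) := inferInstanceAs (Module k (QuiverPath V →₀ k))

/-- The basis vector given by a path. -/
def ofPath (p : QuiverPath V) : PathAlgebra k V := Finsupp.single p (1 : k)

/-- The trivial path at a vertex. -/
def vertex (a : V) : PathAlgebra k V := ofPath k ⟨a, a, Quiver.Path.nil⟩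

/-- The path of length one given by an arrow. -/
def arrow {a b : V} (f : a ⟶ b) : PathAlgebra k V := ofPath k ⟨a, b, f.toPath⟩

open Classical in
/-- The product of two paths, read from left to right: first `p`, then `q`, if `p` ends where `q`
starts; zero otherwise. -/
def pathMul (p q : QuiverPath V) : PathAlgebra k V :=
  if h : q.1 = p.2.1 then ofPath k ⟨p.1, q.2.1, p.2.2.comp (q.2.2.cast h rfl)⟩ else 0

/-- The bilinear extension of the product of paths. -/
def mulHom : PathAlgebra k V →ₗ[k] PathAlgebra k V →ₗ[k] PathAlgebra k V :=
  Finsupp.lift (PathAlgebra k V →ₗ[k] PathAlgebra k V) k (QuiverPath V) fun p =>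
    Finsupp.lift (PathAlgebra k V) k (QuiverPath V) fun q => pathMul k p q

instance : Mul (PathAlgebra k V) := ⟨fun x y => mulHom k x y⟩

/-- The unit is the sum of all trivial paths. -/
instance [Fintype V] : One (PathAlgebra k V) := ⟨∑ a : V, vertex k a⟩

variable {k}

theorem mul_def (x y : PathAlgebra k V) : x * y = mulHom k x y := rfl

theorem one_def [Fintype V] : (1 : PathAlgebra k V) = ∑ a : V, vertex k a := rfl

theorem ofPath_mul_ofPath (p q : QuiverPath V) :
    ofPath k p * ofPath k q = pathMul k p q := by
  have h₁ : mulHom k (ofPath k p) =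
      Finsupp.lift (PathAlgebra k V) k (QuiverPath V) fun q => pathMul k p q :=
    (Finsupp.sum_single_index (by exact zero_smul k _)).trans (one_smul k _)
  rw [mul_def, h₁]
  exact (Finsupp.sum_single_index (by exact zero_smul k _)).trans (one_smul k _)

theorem pathMul_of_eq {a b c : V} (p : Quiver.Path a b) (q : Quiver.Path b c) :
    pathMul k ⟨a, b, p⟩ ⟨b, c, q⟩ = ofPath k ⟨a, c, p.comp q⟩ := by
  simp [pathMul]

theorem pathMul_of_ne {a b c d : V} (p : Quiver.Path a b) (q : Quiver.Path c d) (h : c ≠ b) :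
    pathMul k ⟨a, b, p⟩ ⟨c, d, q⟩ = 0 := by
  simp [pathMul, h]

theorem vertex_mul_vertex (a : V) : vertex k a * vertex k a = vertex k a := by
  rw [vertex, ofPath_mul_ofPath, pathMul_of_eq, Quiver.Path.comp_nil]

theorem hom_ext {M : Type*} [AddCommGroup M] [Module k M] {f g : PathAlgebra k V →ₗ[k] M}
    (h : ∀ p, f (ofPath k p) = g (ofPath k p)) : f = g :=
  Finsupp.lhom_ext' fun p => LinearMap.ext_ring (h p)

theorem mulHom_assoc (x y z : PathAlgebra k V) :
    mulHom k (mulHom k x y) z = mulHom k x (mulHom k y z) := by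
  have key : (mulHom k (V := V)).compr₂ (mulHom k) =
      ((LinearMap.llcomp k _ _ _).flip (mulHom k (V := V)) ∘ₗ
        LinearMap.llcomp k _ _ _) ∘ₗ mulHom k := by
    refine hom_ext fun p => hom_ext fun q => hom_ext fun r => ?_
    simp only [LinearMap.compr₂_apply, LinearMap.comp_apply, LinearMap.flip_apply,
      LinearMap.llcomp_apply, ← mul_def]
    obtain ⟨a, b, p⟩ := p
    obtain ⟨c, d, q⟩ := q
    obtain ⟨e, f, r⟩ := r
    rw [ofPath_mul_ofPath, ofPath_mul_ofPath]
    by_cases h₁ : c = b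
    · subst h₁
      rw [pathMul_of_eq]
      by_cases h₂ : e = d
      · subst h₂
        rw [pathMul_of_eq, ofPath_mul_ofPath, ofPath_mul_ofPath, pathMul_of_eq, pathMul_of_eq,
          Quiver.Path.comp_assoc]
      · rw [pathMul_of_ne _ _ h₂, ofPath_mul_ofPath, pathMul_of_ne _ _ h₂]
        simp [mul_def]
    · rw [pathMul_of_ne _ _ h₁]
      by_cases h₂ : e = d
      · subst h₂
        rw [pathMul_of_eq, ofPath_mul_ofPath, pathMul_of_ne _ _ h₁]
        simp [mul_def]
      · rw [pathMul_of_ne _ _ h₂]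
        simp [mul_def]
  exact LinearMap.congr_fun (LinearMap.congr_fun (LinearMap.congr_fun key x) y) z

theorem mulHom_one [Fintype V] (x : PathAlgebra k V) : mulHom k x 1 = x := by
  have key : (mulHom k (V := V)).flip 1 = LinearMap.id := by
    refine hom_ext fun p => ?_
    obtain ⟨a, b, p⟩ := p
    rw [LinearMap.flip_apply, one_def, map_sum, LinearMap.id_apply, Finset.sum_eq_single b]
    · rw [← mul_def, vertex, ofPath_mul_ofPath, pathMul_of_eq, Quiver.Path.comp_nil]
    · intro c _ hc
      rw [← mul_def, vertex, ofPath_mul_ofPath, pathMul_of_ne _ _ hc]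
    · simp
  exact LinearMap.congr_fun key x

theorem one_mulHom [Fintype V] (x : PathAlgebra k V) : mulHom k 1 x = x := by
  have key : mulHom k (V := V) 1 = LinearMap.id := by
    refine hom_ext fun p => ?_
    obtain ⟨a, b, p⟩ := p
    rw [one_def, map_sum, LinearMap.sum_apply, LinearMap.id_apply, Finset.sum_eq_single a]
    · rw [← mul_def, vertex, ofPath_mul_ofPath, pathMul_of_eq, Quiver.Path.nil_comp]
    · intro c _ hc
      rw [← mul_def, vertex, ofPath_mul_ofPath, pathMul_of_ne _ _ hc.symm]
    · simp
  exact LinearMap.congr_fun key x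

instance [Fintype V] : Ring (PathAlgebra k V) where
  __ := (inferInstance : AddCommGroup (PathAlgebra k V))
  mul := (· * ·)
  one := 1
  left_distrib x y z := by simp [mul_def]
  right_distrib x y z := by simp [mul_def]
  zero_mul x := by simp [mul_def]
  mul_zero x := by simp [mul_def]
  mul_assoc := mulHom_assoc
  one_mul := one_mulHom
  mul_one := mulHom_one

instance [Fintype V] : Algebra k (PathAlgebra k V) :=
  Algebra.ofModule (fun c x y => by simp [mul_def]) (fun c x y => by simp [mul_def])

/-- The arrow ideal: the two-sided ideal generated by all arrows. -/
def arrowIdeal (k V : Type*) [Field k] [Quiver V] [Fintype V] : Ideal (PathAlgebra k V) :=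
  (TwoSidedIdeal.span {x | ∃ (a b : V) (f : a ⟶ b), x = arrow k f}).asIdeal

instance [Fintype V] : (arrowIdeal k V).IsTwoSided :=
  inferInstanceAs (TwoSidedIdeal.asIdeal _).IsTwoSided

end PathAlgebra

/-! ## The bound quiver algebra of the `n`-cycle -/

/-- The `n`-cycle quiver: its vertices are the residues modulo `n`, and its arrows are exactly one
arrow `i ⟶ i + 1` for each `i`. -/
instance cycleQuiver (n : ℕ) : Quiver (ZMod n) := ⟨fun i j => PLift (j = i + 1)⟩

/-- The arrow `i ⟶ i + 1` of the `n`-cycle quiver. -/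
def cycleArrow {n : ℕ} (i : ZMod n) : i ⟶ i + 1 := PLift.up rfl

/-- The path algebra of the `n`-cycle quiver modulo the `ℓ`-th power of its arrow ideal. -/
def BoundCycle (k : Type*) [Field k] (n ℓ : ℕ) [NeZero n] :=
  PathAlgebra k (ZMod n) ⧸ PathAlgebra.arrowIdeal k (ZMod n) ^ ℓ

namespace BoundCycle

variable (k : Type*) [Field k] (n ℓ : ℕ) [NeZero n]

instance : Ring (BoundCycle k n ℓ) :=
  inferInstanceAs (Ring (PathAlgebra k (ZMod n) ⧸ PathAlgebra.arrowIdeal k (ZMod n) ^ ℓ))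

instance : Algebra k (BoundCycle k n ℓ) :=
  inferInstanceAs (Algebra k (PathAlgebra k (ZMod n) ⧸ PathAlgebra.arrowIdeal k (ZMod n) ^ ℓ))

/-- The quotient map from the path algebra. -/
def mk : PathAlgebra k (ZMod n) →ₐ[k] BoundCycle k n ℓ := Ideal.Quotient.mkₐ k _

variable {n}

/-- The class of the trivial path at the vertex `i`. -/
def e (i : ZMod n) : BoundCycle k n ℓ :=
  mk k n ℓ (PathAlgebra.vertex k i)

/-- The class of the arrow `i ⟶ i + 1`. -/
def arr (i : ZMod n) : BoundCycle k n ℓ :=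
  mk k n ℓ (PathAlgebra.arrow k (cycleArrow i))

/-- The class `α_{i,j}` of the path of length `j` starting at the vertex `i`; in particular
`α_{i,0} = e_i`. -/
def path (i : ZMod n) : ℕ → BoundCycle k n ℓ
  | 0 => e k ℓ i
  | j + 1 => path i j * arr k ℓ (i + (j : ZMod n))

theorem e_mul_path (i : ZMod n) (j : ℕ) : e k ℓ i * path k ℓ i j = path k ℓ i j := by
  induction j with
  | zero =>
    change e k ℓ i * e k ℓ i = e k ℓ i
    rw [e, ← map_mul, PathAlgebra.vertex_mul_vertex]
  | succ j ih => rw [path, ← mul_assoc, ih]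

/-- The right module `P_i = e_i B`, as a submodule of `B` over the opposite ring of `B`. -/
def P (i : ZMod n) : Submodule (BoundCycle k n ℓ)ᵐᵒᵖ (BoundCycle k n ℓ) :=
  Submodule.span (BoundCycle k n ℓ)ᵐᵒᵖ {e k ℓ i}

theorem mem_P_iff (i : ZMod n) (x : BoundCycle k n ℓ) : x ∈ P k ℓ i ↔ ∃ b, x = e k ℓ i * b := by
  rw [P, Submodule.mem_span_singleton]
  constructor
  · rintro ⟨b, rfl⟩
    exact ⟨b.unop, rfl⟩
  · rintro ⟨b, rfl⟩
    exact ⟨MulOpposite.op b, rfl⟩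

/-- Left multiplication by `α_{i,j}`, as a map of right modules `P_{i+j} → P_i`. -/
def precomp (i : ZMod n) (j : ℕ) : P k ℓ (i + (j : ZMod n)) →ₗ[(BoundCycle k n ℓ)ᵐᵒᵖ] P k ℓ i where
  toFun v := ⟨path k ℓ i j * v, by
    rw [mem_P_iff]
    exact ⟨path k ℓ i j * v, by rw [← mul_assoc, e_mul_path]⟩⟩
  map_add' v w := by
    ext
    simp [mul_add]
  map_smul' b v := by
    ext
    simp [mul_assoc]

end BoundCycle

/-! ## The algebras `B_{n,ℓ}(m_0, …, m_{n-1})` -/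

/-- The right module `⨁ i, P_i ^ (m i)`: one summand for each pair of a vertex `i` and a number
`r < m i`. -/
abbrev NSYModule (k : Type*) [Field k] {n : ℕ} [NeZero n] (ℓ : ℕ) (m : ZMod n → ℕ) :=
  (x : Σ i : ZMod n, Fin (m i)) → BoundCycle.P k ℓ x.1

/-- The endomorphism algebra of the right module `⨁ i, P_i ^ (m i)`, with composition as product. -/
def NSYAlgebra (k : Type*) [Field k] {n : ℕ} [NeZero n] (ℓ : ℕ) (m : ZMod n → ℕ) :=
  Module.End (BoundCycle k n ℓ)ᵐᵒᵖ (NSYModule k ℓ m)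

instance (k : Type*) [Field k] {n : ℕ} [NeZero n] (ℓ : ℕ) (m : ZMod n → ℕ) :
    Ring (NSYAlgebra k ℓ m) :=
  inferInstanceAs (Ring (Module.End (BoundCycle k n ℓ)ᵐᵒᵖ (NSYModule k ℓ m)))

instance (k : Type*) [Field k] {n : ℕ} [NeZero n] (ℓ : ℕ) (m : ZMod n → ℕ) :
    Algebra k (NSYAlgebra k ℓ m) :=
  inferInstanceAs (Algebra k (Module.End (BoundCycle k n ℓ)ᵐᵒᵖ (NSYModule k ℓ m)))

/-- The elements of the algebra, seen as endomorphisms. -/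
def NSYAlgebra.toEnd (k : Type*) [Field k] {n : ℕ} [NeZero n] (ℓ : ℕ) (m : ZMod n → ℕ) :
    NSYAlgebra k ℓ m ≃ₐ[k] Module.End (BoundCycle k n ℓ)ᵐᵒᵖ (NSYModule k ℓ m) :=
  AlgEquiv.refl

/-- The endomorphism `X_{i,j}^{r,s}`, which maps the copy of `P_{i+j}` with number `s` to the copy of
`P_i` with number `r` by left multiplication by `α_{i,j}`, and is zero on all other summands. It is
used only for `r < m i` and `s < m (i + j)`, and set to zero otherwise. -/
def nsyX (k : Type*) [Field k] {n : ℕ} [NeZero n] (ℓ : ℕ) (m : ZMod n → ℕ)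
    (i : ZMod n) (j r s : ℕ) : NSYAlgebra k ℓ m :=
  if h : r < m i ∧ s < m (i + j) then
    (NSYAlgebra.toEnd k ℓ m).symm
      (LinearMap.single (BoundCycle k n ℓ)ᵐᵒᵖ
          (fun x : Σ i : ZMod n, Fin (m i) => BoundCycle.P k ℓ x.1) ⟨i, ⟨r, h.1⟩⟩ ∘ₗ
        BoundCycle.precomp k ℓ i j ∘ₗ
        LinearMap.proj (φ := fun x : Σ i : ZMod n, Fin (m i) => BoundCycle.P k ℓ x.1)
          ⟨i + j, ⟨s, h.2⟩⟩)
  else 0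

/-- The admissible indices `(i, j, r, s)`: `0 ≤ j < ℓ`, `0 ≤ r < m i` and `0 ≤ s < m (i + j)`. -/
abbrev NSYIndex {n : ℕ} (ℓ : ℕ) (m : ZMod n → ℕ) :=
  {x : ZMod n × ℕ × ℕ × ℕ //
    x.2.1 < ℓ ∧ x.2.2.1 < m x.1 ∧ x.2.2.2 < m (x.1 + (x.2.1 : ZMod n))}

/-! ## Frobenius structures -/

/-- `Δ` is a coassociative map of `A`-bimodules, where `A` acts on `A ⊗ A` from the left on the first
and from the right on the second factor. -/
structure IsNonCounitalFrobenius {k A : Type*} [Field k] [Ring A] [Algebra k A]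
    (Δ : A →ₗ[k] A ⊗[k] A) : Prop where
  coassoc : (TensorProduct.assoc k A A A).toLinearMap ∘ₗ Δ.rTensor A ∘ₗ Δ = Δ.lTensor A ∘ₗ Δ
  map_mul_left : ∀ a x : A, Δ (a * x) = (LinearMap.mulLeft k a).rTensor A (Δ x)
  map_mul_right : ∀ x a : A, Δ (x * a) = (LinearMap.mulRight k a).lTensor A (Δ x)

/-- `ε` is a counit of `Δ`. -/
structure IsCounitOf {k A : Type*} [Field k] [Ring A] [Algebra k A]
    (Δ : A →ₗ[k] A ⊗[k] A) (ε : A →ₗ[k] k) : Prop where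
  left : (TensorProduct.lid k A).toLinearMap ∘ₗ ε.rTensor A ∘ₗ Δ = LinearMap.id
  right : (TensorProduct.rid k A).toLinearMap ∘ₗ ε.lTensor A ∘ₗ Δ = LinearMap.id

/-- `A` is a Frobenius algebra: it admits a coassociative and counital comultiplication which is a map
of `A`-bimodules. -/
def IsFrobeniusAlgebra (k A : Type*) [Field k] [Ring A] [Algebra k A] : Prop :=
  ∃ (Δ : A →ₗ[k] A ⊗[k] A) (ε : A →ₗ[k] k), IsNonCounitalFrobenius Δ ∧ IsCounitOf Δ ε

end

/-!
The elements `X_{i,j}^{r,s}` multiply like matrix units decorated with paths, and comparing the two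
sides of `Δ (a * x) = a • Δ x` and `Δ (x * a) = Δ x • a` on them shows that `Δ` is a bimodule map:
the coefficients depend only on the vertex where the path is cut and on `t` and `u`, and the terms
that would have to appear or disappear contain a path of length at least `ℓ`. Coassociativity is
then automatic, because `Δ a = a • Δ 1 = Δ 1 • a`.

A counit of a bimodule map makes `(x, y) ↦ ε (x * y)` a nondegenerate pairing. The `m_{i+ℓ-1}`
elements `X_{i,ℓ-1}^{0,s}` pair to zero with all basis elements except the `m_i` elements
`X_{i,0}^{r,0}`, so `m_{i+ℓ-1} ≤ m_i`; summing over the cycle turns these inequalities into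
equalities.
-/

noncomputable section

section Frobenius

variable {k A : Type*} [Field k] [Ring A] [Algebra k A]

/-- The left action of `A` on the first factor of `A ⊗ A`, with the tensor as the first argument. -/
def leftAct : A ⊗[k] A →ₗ[k] A →ₗ[k] A ⊗[k] A :=
  (LinearMap.rTensorHom A ∘ₗ LinearMap.mul k A).flip

/-- The right action of `A` on the second factor of `A ⊗ A`, with the tensor as the first
argument. -/
def rightAct : A ⊗[k] A →ₗ[k] A →ₗ[k] A ⊗[k] A :=
  (LinearMap.lTensorHom A ∘ₗ (LinearMap.mul k A).flip).flip

theorem leftAct_apply (t : A ⊗[k] A) (a : A) :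
    leftAct t a = (LinearMap.mulLeft k a).rTensor A t := rfl

theorem rightAct_apply (t : A ⊗[k] A) (a : A) :
    rightAct t a = (LinearMap.mulRight k a).lTensor A t := rfl

theorem assoc_rTensor_rightAct (t u : A ⊗[k] A) :
    TensorProduct.assoc k A A A ((rightAct t).rTensor A u) = (leftAct u).lTensor A t := by
  induction t with
  | zero => simp
  | add t₁ t₂ h₁ h₂ => simp only [map_add, LinearMap.rTensor_add, LinearMap.add_apply, h₁, h₂]
  | tmul x y =>
    induction u with
    | zero => simp
    | add u₁ u₂ h₁ h₂ => simp only [map_add, LinearMap.lTensor_add, LinearMap.add_apply, h₁, h₂]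
    | tmul z w => simp [leftAct_apply, rightAct_apply]

theorem coassoc_of_map_mul {Δ : A →ₗ[k] A ⊗[k] A} (hl : ∀ a x, Δ (a * x) = leftAct (Δ x) a)
    (hr : ∀ x a, Δ (x * a) = rightAct (Δ x) a) :
    (TensorProduct.assoc k A A A).toLinearMap ∘ₗ Δ.rTensor A ∘ₗ Δ = Δ.lTensor A ∘ₗ Δ := by
  have hΔ : Δ = rightAct (Δ 1) := LinearMap.ext fun a => by rw [← hr, one_mul]
  have hleft (a : A) : leftAct (Δ a) = Δ ∘ₗ LinearMap.mulRight k a :=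
    LinearMap.ext fun c => (hl c a).symm
  refine LinearMap.ext fun a => ?_
  -- If `Δ 1 = ∑ xᵢ ⊗ yᵢ`, then both sides are `∑ (a xᵢ) ⊗ (yᵢ xⱼ) ⊗ yⱼ`.
  calc TensorProduct.assoc k A A A (Δ.rTensor A (Δ a))
      = TensorProduct.assoc k A A A ((rightAct (Δ 1)).rTensor A (Δ a)) := by rw [← hΔ]
    _ = (leftAct (Δ a)).lTensor A (Δ 1) := assoc_rTensor_rightAct _ _
    _ = Δ.lTensor A (rightAct (Δ 1) a) := by
      rw [hleft, LinearMap.lTensor_comp, LinearMap.comp_apply, rightAct_apply]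
    _ = Δ.lTensor A (Δ a) := by rw [← hr, one_mul]

theorem isNonCounitalFrobenius_of_basis {ι : Type*} (b : Module.Basis ι k A)
    {Δ : A →ₗ[k] A ⊗[k] A} (hl : ∀ i j, Δ (b i * b j) = leftAct (Δ (b j)) (b i))
    (hr : ∀ i j, Δ (b i * b j) = rightAct (Δ (b i)) (b j)) : IsNonCounitalFrobenius Δ := by
  have hleft : (LinearMap.mul k A).compr₂ Δ = (leftAct ∘ₗ Δ).flip := LinearMap.ext_basis b b hl
  have hright : (LinearMap.mul k A).compr₂ Δ = rightAct ∘ₗ Δ := LinearMap.ext_basis b b hr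
  have hl' (a x : A) : Δ (a * x) = leftAct (Δ x) a := LinearMap.congr_fun₂ hleft a x
  have hr' (x a : A) : Δ (x * a) = rightAct (Δ x) a := LinearMap.congr_fun₂ hright x a
  exact ⟨coassoc_of_map_mul hl' hr', hl', hr'⟩

theorem IsNonCounitalFrobenius.eq_zero_of_counit_mul_eq_zero {Δ : A →ₗ[k] A ⊗[k] A}
    {ε : A →ₗ[k] k} (hΔ : IsNonCounitalFrobenius Δ) (hε : IsCounitOf Δ ε) {v : A}
    (hv : ∀ a, ε (a * v) = 0) : v = 0 := by
  have hεv : ε ∘ₗ LinearMap.mulRight k v = 0 := LinearMap.ext hv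
  calc v = TensorProduct.rid k A (ε.lTensor A (Δ (1 * v))) := by
        rw [one_mul]
        exact (LinearMap.congr_fun hε.right v).symm
    _ = TensorProduct.rid k A ((ε ∘ₗ LinearMap.mulRight k v).lTensor A (Δ 1)) := by
        rw [hΔ.map_mul_right, LinearMap.lTensor_comp, LinearMap.comp_apply]
    _ = 0 := by rw [hεv, LinearMap.lTensor_zero, LinearMap.zero_apply, map_zero]

theorem IsFrobeniusAlgebra.card_le_of_mul_eq_zero (hA : IsFrobeniusAlgebra k A) {ι κ : Type*}
    [Fintype ι] [Fintype κ] {x : κ → A} (hx : LinearIndependent k x) {y : ι → A} {S : Set A}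
    (hS : Submodule.span k S = ⊤) (hy : ∀ b ∈ S, b ∈ Set.range y ∨ ∀ s, b * x s = 0) :
    Fintype.card κ ≤ Fintype.card ι := by
  obtain ⟨Δ, ε, hΔ, hε⟩ := hA
  -- The forms `v ↦ ε (y r * v)` separate the points of the span of `x`.
  let φ : (κ → k) →ₗ[k] ι → k :=
    LinearMap.pi fun r => ε ∘ₗ LinearMap.mulLeft k (y r) ∘ₗ Fintype.linearCombination k x
  have hφ : Function.Injective φ := by
    rw [injective_iff_map_eq_zero]
    intro c hc
    set v := Fintype.linearCombination k x c with hv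
    have hεv : ε ∘ₗ LinearMap.mulRight k v = 0 := by
      refine LinearMap.ext_on hS fun b hb => ?_
      rcases hy b hb with ⟨r, rfl⟩ | hbx
      · exact congrFun hc r
      · have hbv : b * v = 0 := by
          simp [hv, Fintype.linearCombination_apply, Finset.mul_sum, hbx]
        simp [hbv]
    have hv₀ : v = 0 := hΔ.eq_zero_of_counit_mul_eq_zero hε (LinearMap.congr_fun hεv)
    exact (injective_iff_map_eq_zero _).1
      (linearIndependent_iff_injective_fintypeLinearCombination.1 hx) c hv₀
  simpa using LinearMap.finrank_le_finrank_of_injective hφ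

end Frobenius

namespace PathAlgebra

variable {k V : Type*} [Field k] [Quiver V]

variable (k V) in
/-- The span of the paths of length at least `d`. When there are finitely many vertices, it
is the `d`-th power of the arrow ideal. -/
def lengthGE (d : ℕ) : Submodule k (PathAlgebra k V) :=
  Submodule.span k (ofPath k '' {p | d ≤ p.2.2.length})

theorem ofPath_mem_lengthGE {p : QuiverPath V} {d : ℕ} (h : d ≤ p.2.2.length) :
    ofPath k p ∈ lengthGE k V d :=
  Submodule.subset_span ⟨p, h, rfl⟩

theorem lengthGE_zero : lengthGE k V 0 = ⊤ := by
  rw [← Submodule.ker_mkQ (lengthGE k V 0), LinearMap.ker_eq_top]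
  exact hom_ext fun p => (Submodule.Quotient.mk_eq_zero _).2 (ofPath_mem_lengthGE (Nat.zero_le _))

open Classical in
/-- The sum of the coefficients of the paths of length `j` that start at `i`. On the cycle quiver
there is exactly one such path, so this is its coefficient. -/
def coeffSum (k : Type*) {V : Type*} [Field k] [Quiver V] (i : V) (j : ℕ) :
    PathAlgebra k V →ₗ[k] k :=
  Finsupp.lift k k (QuiverPath V) fun p => if p.1 = i ∧ p.2.2.length = j then 1 else 0

open Classical in
theorem coeffSum_ofPath (i : V) (j : ℕ) (p : QuiverPath V) :
    coeffSum k i j (ofPath k p) = if p.1 = i ∧ p.2.2.length = j then 1 else 0 :=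
  (Finsupp.sum_single_index (by exact zero_smul k _)).trans (one_smul k _)

theorem lengthGE_le_ker_coeffSum (i : V) {j d : ℕ} (hj : j < d) :
    lengthGE k V d ≤ LinearMap.ker (coeffSum k i j) := by
  rw [lengthGE, Submodule.span_le]
  rintro _ ⟨p, hp, rfl⟩
  rw [SetLike.mem_coe, LinearMap.mem_ker, coeffSum_ofPath,
    if_neg fun h => (hj.trans_le hp).ne' h.2]

theorem ofPath_cons {a b c : V} (p : Quiver.Path a b) (f : b ⟶ c) :
    ofPath k ⟨a, c, p.cons f⟩ = ofPath k ⟨a, b, p⟩ * arrow k f := by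
  rw [arrow, ofPath_mul_ofPath, pathMul_of_eq]
  rfl

theorem mul_mem_lengthGE {c d : ℕ} {x y : PathAlgebra k V} (hx : x ∈ lengthGE k V c)
    (hy : y ∈ lengthGE k V d) : x * y ∈ lengthGE k V (c + d) := by
  have hle : Submodule.map₂ (mulHom k) (lengthGE k V c) (lengthGE k V d) ≤
      lengthGE k V (c + d) := by
    rw [lengthGE, lengthGE, Submodule.map₂_span_span, Submodule.span_le, Set.image2_subset_iff]
    rintro _ ⟨⟨a, b, p⟩, hp, rfl⟩ _ ⟨⟨b', e, q⟩, hq, rfl⟩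
    rw [← mul_def, ofPath_mul_ofPath, SetLike.mem_coe]
    by_cases h : b' = b
    · subst h
      rw [pathMul_of_eq]
      exact ofPath_mem_lengthGE ((add_le_add hp hq).trans_eq (Quiver.Path.length_comp p q).symm)
    · rw [pathMul_of_ne _ _ h]
      exact zero_mem _
  exact hle (Submodule.apply_mem_map₂ _ hx hy)

variable [Fintype V]

theorem mem_lengthGE_one_of_mem_arrowIdeal {x : PathAlgebra k V} (hx : x ∈ arrowIdeal k V) :
    x ∈ lengthGE k V 1 := by
  have mem_zero (y : PathAlgebra k V) : y ∈ lengthGE k V 0 := by simp [lengthGE_zero]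
  let J : TwoSidedIdeal (PathAlgebra k V) :=
    .mk' (lengthGE k V 1 : Set (PathAlgebra k V)) (zero_mem _) add_mem neg_mem
      (fun hy => zero_add 1 ▸ mul_mem_lengthGE (mem_zero _) hy)
      (fun hx => add_zero 1 ▸ mul_mem_lengthGE hx (mem_zero _))
  have hJ : TwoSidedIdeal.span {x | ∃ (a b : V) (f : a ⟶ b), x = arrow k f} ≤ J := by
    rw [TwoSidedIdeal.span_le]
    rintro _ ⟨a, b, f, rfl⟩
    rw [SetLike.mem_coe, TwoSidedIdeal.mem_mk']
    exact ofPath_mem_lengthGE le_rfl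
  simpa [J] using hJ (TwoSidedIdeal.mem_asIdeal.1 hx)

theorem arrowIdeal_pow_le_lengthGE (d : ℕ) :
    (arrowIdeal k V ^ d).restrictScalars k ≤ lengthGE k V d := by
  induction d with
  | zero => simp [lengthGE_zero]
  | succ d ih =>
    intro x hx
    rw [Submodule.restrictScalars_mem, Submodule.pow_succ] at hx
    exact Submodule.mul_induction_on hx
      (fun y hy z hz => mul_mem_lengthGE (ih hy) (mem_lengthGE_one_of_mem_arrowIdeal hz))
      fun _ _ => add_mem

theorem arrow_mem_arrowIdeal {a b : V} (f : a ⟶ b) : arrow k f ∈ arrowIdeal k V :=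
  TwoSidedIdeal.mem_asIdeal.2 (TwoSidedIdeal.subset_span ⟨a, b, f, rfl⟩)

theorem ofPath_mem_arrowIdeal_pow {a b : V} (p : Quiver.Path a b) :
    ofPath k ⟨a, b, p⟩ ∈ arrowIdeal k V ^ p.length := by
  induction p with
  | nil => simp [Submodule.pow_zero, Ideal.one_eq_top]
  | cons p f ih =>
    rw [ofPath_cons, Quiver.Path.length_cons, Submodule.pow_succ]
    exact Ideal.mul_mem_mul ih (arrow_mem_arrowIdeal f)

end PathAlgebra

namespace BoundCycle

variable {k : Type*} [Field k] {n ℓ : ℕ}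

theorem cyclePath_target {a b : ZMod n} (p : Quiver.Path a b) : b = a + p.length := by
  induction p with
  | nil => simp
  | cons p f ih =>
    rw [Quiver.Path.length_cons, Nat.cast_succ, ← add_assoc, ← ih]
    exact f.down

theorem exists_cyclePath_length_eq (i : ZMod n) (j : ℕ) :
    ∃ (b : ZMod n) (p : Quiver.Path i b), p.length = j := by
  induction j with
  | zero => exact ⟨i, .nil, rfl⟩
  | succ j ih =>
    obtain ⟨b, p, rfl⟩ := ih
    exact ⟨b + 1, p.cons (cycleArrow b), rfl⟩

variable [NeZero n]

theorem mk_ofPath {a b : ZMod n} (p : Quiver.Path a b) :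
    mk k n ℓ (PathAlgebra.ofPath k ⟨a, b, p⟩) = path k ℓ a p.length := by
  induction p with
  | nil => rfl
  | @cons b c p f ih =>
    obtain ⟨rfl⟩ := f
    rw [PathAlgebra.ofPath_cons, map_mul, ih, Quiver.Path.length_cons, path, ← cyclePath_target p]
    rfl

theorem path_mul_path (i h : ZMod n) (j q : ℕ) :
    path k ℓ i j * path k ℓ h q = if h = i + j then path k ℓ i (j + q) else 0 := by
  obtain ⟨b, p, rfl⟩ := exists_cyclePath_length_eq i j
  obtain ⟨c, p', rfl⟩ := exists_cyclePath_length_eq h q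
  rw [← mk_ofPath, ← mk_ofPath, ← map_mul, PathAlgebra.ofPath_mul_ofPath, ← cyclePath_target p]
  split_ifs with hb
  · subst hb
    rw [PathAlgebra.pathMul_of_eq, mk_ofPath, Quiver.Path.length_comp]
  · rw [PathAlgebra.pathMul_of_ne _ _ hb, map_zero]

theorem path_mul_e (i h : ZMod n) (j : ℕ) :
    path k ℓ i j * e k ℓ h = if h = i + j then path k ℓ i j else 0 :=
  path_mul_path i h j 0

theorem e_mul_path_eq_ite (i h : ZMod n) (q : ℕ) :
    e k ℓ i * path k ℓ h q = if h = i then path k ℓ i q else 0 := by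
  simpa [path] using path_mul_path (k := k) (ℓ := ℓ) i h 0 q

theorem path_eq_zero (i : ZMod n) {j : ℕ} (h : ℓ ≤ j) : path k ℓ i j = 0 := by
  obtain ⟨b, p, rfl⟩ := exists_cyclePath_length_eq i j
  rw [← mk_ofPath]
  exact Ideal.Quotient.eq_zero_iff_mem.2
    (Ideal.pow_le_pow_right h (PathAlgebra.ofPath_mem_arrowIdeal_pow p))

/-- The coefficient of the path of length `j` that starts at `i`, for `j < ℓ`. -/
def coeff (i : ZMod n) (j : Fin ℓ) : BoundCycle k n ℓ →ₗ[k] k :=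
  show (PathAlgebra k (ZMod n) ⧸ PathAlgebra.arrowIdeal k (ZMod n) ^ ℓ) →ₗ[k] k from
    Submodule.liftQ _ (PathAlgebra.coeffSum k i j)
        ((PathAlgebra.arrowIdeal_pow_le_lengthGE ℓ).trans
          (PathAlgebra.lengthGE_le_ker_coeffSum i j.2)) ∘ₗ
      (Submodule.Quotient.restrictScalarsEquiv k
        (PathAlgebra.arrowIdeal k (ZMod n) ^ ℓ)).symm.toLinearMap

theorem coeff_mk (i : ZMod n) (j : Fin ℓ) (x : PathAlgebra k (ZMod n)) :
    coeff i j (mk k n ℓ x) = PathAlgebra.coeffSum k i j x := rfl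

theorem coeff_path (i h : ZMod n) (j : Fin ℓ) (q : ℕ) :
    coeff i j (path k ℓ h q) = if h = i ∧ q = j then 1 else 0 := by
  obtain ⟨b, p, rfl⟩ := exists_cyclePath_length_eq h q
  classical
  rw [← mk_ofPath, coeff_mk, PathAlgebra.coeffSum_ofPath]
  congr

variable (k n ℓ)

theorem linearIndependent_path :
    LinearIndependent k fun x : ZMod n × Fin ℓ => path k ℓ x.1 x.2 := by
  refine .of_pairwise_dual_eq_zero_one _ (fun x => coeff x.1 x.2) (fun x y hxy => ?_) fun x => ?_
  · change coeff x.1 x.2 (path k ℓ y.1 y.2) = 0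
    rw [coeff_path, if_neg fun h => hxy (Prod.ext h.1 (Fin.ext h.2)).symm]
  · exact (coeff_path _ _ _ _).trans (if_pos ⟨rfl, rfl⟩)

theorem span_path :
    Submodule.span k (Set.range fun x : ZMod n × Fin ℓ => path k ℓ x.1 x.2) = ⊤ := by
  set W := Submodule.span k (Set.range fun x : ZMod n × Fin ℓ => path k ℓ x.1 x.2)
  have hW (i : ZMod n) (j : ℕ) : path k ℓ i j ∈ W := by
    rcases lt_or_ge j ℓ with hj | hj
    · exact Submodule.subset_span ⟨(i, ⟨j, hj⟩), rfl⟩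
    · rw [path_eq_zero i hj]
      exact zero_mem W
  have hmk : W.mkQ ∘ₗ (mk k n ℓ).toLinearMap = 0 := by
    refine PathAlgebra.hom_ext fun ⟨a, b, p⟩ => (Submodule.Quotient.mk_eq_zero W).2 ?_
    rw [AlgHom.toLinearMap_apply, mk_ofPath]
    exact hW a p.length
  refine eq_top_iff.2 fun x _ => ?_
  obtain ⟨x, rfl⟩ : ∃ y, mk k n ℓ y = x := Ideal.Quotient.mk_surjective x
  exact (Submodule.Quotient.mk_eq_zero W).1 (LinearMap.congr_fun hmk x)

/-- The basis of the paths of length less than `ℓ`. -/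
def pathBasis : Module.Basis (ZMod n × Fin ℓ) k (BoundCycle k n ℓ) :=
  .mk (linearIndependent_path k n ℓ) (span_path k n ℓ).ge

variable {k n ℓ}

theorem pathBasis_apply (x : ZMod n × Fin ℓ) : pathBasis k n ℓ x = path k ℓ x.1 x.2 :=
  Module.Basis.mk_apply _ _ x

theorem ext_coeff {x y : BoundCycle k n ℓ} (hxy : ∀ i j, coeff i j x = coeff i j y) : x = y := by
  have hcoeff (i : ZMod n) (j : Fin ℓ) : coeff i j = (pathBasis k n ℓ).coord (i, j) := by
    refine (pathBasis k n ℓ).ext fun y => ?_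
    rw [Module.Basis.coord_apply, Module.Basis.repr_self, pathBasis_apply, coeff_path,
      Finsupp.single_apply]
    simp only [Prod.ext_iff, Fin.ext_iff]
  refine (pathBasis k n ℓ).ext_elem fun ⟨i, j⟩ => ?_
  simpa only [hcoeff, Module.Basis.coord_apply] using hxy i j

theorem coeff_eq_zero_of_mul {i h a : ZMod n} {j : Fin ℓ} {x : BoundCycle k n ℓ}
    (hi : e k ℓ i * x = x) (hh : x * e k ℓ h = x) (hne : ¬(a = i ∧ h = a + (j : ℕ))) :
    coeff a j x = 0 := by
  have hzero :
      coeff a j ∘ₗ LinearMap.mulRight k (e k ℓ h) ∘ₗ LinearMap.mulLeft k (e k ℓ i) = 0 := by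
    refine (pathBasis k n ℓ).ext fun ⟨b, q⟩ => ?_
    simp only [pathBasis_apply, LinearMap.comp_apply, LinearMap.mulLeft_apply,
      LinearMap.mulRight_apply, LinearMap.zero_apply, e_mul_path_eq_ite, ite_mul, zero_mul,
      path_mul_e, apply_ite (coeff a j), coeff_path, map_zero]
    grind
  simpa [hi, hh] using LinearMap.congr_fun hzero x

end BoundCycle

namespace NSYAlgebra

open BoundCycle

/-- The index set of the summands of `⨁ i, P_i ^ (m i)`. -/
abbrev Summand {n : ℕ} (m : ZMod n → ℕ) := Σ i : ZMod n, Fin (m i)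

theorem add_sub_add_one_add_cast {n ℓ p : ℕ} (a : ZMod n) (hp : p < ℓ) :
    a + p - ℓ + 1 + (ℓ - 1 - p : ℕ) = a := by
  have h : ((ℓ - 1 - p + p + 1 : ℕ) : ZMod n) = ℓ := congrArg _ (by lia)
  rw [← h]
  push_cast
  ring

variable {k : Type*} [Field k] {n : ℕ} [NeZero n] {ℓ : ℕ} {m : ZMod n → ℕ}

variable (k ℓ) in
/-- The generator `e_i` of `P_i`. -/
def gen (i : ZMod n) : P k ℓ i := ⟨e k ℓ i, Submodule.mem_span_singleton_self _⟩

theorem e_mul_coe {i : ZMod n} (v : P k ℓ i) : e k ℓ i * (v : BoundCycle k n ℓ) = v := by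
  obtain ⟨v, hv⟩ := v
  obtain ⟨b, rfl⟩ := (mem_P_iff k ℓ i v).1 hv
  rw [← mul_assoc]
  exact congrArg (· * b) (e_mul_path k ℓ i 0)

/-- The matrix entry at `(x, y)`: the component at `x` of the image of the generator of the summand
at `y`. -/
def entry (x y : Summand m) : NSYAlgebra k ℓ m →ₗ[k] BoundCycle k n ℓ where
  toFun f := (toEnd k ℓ m f (Pi.single y (gen k ℓ y.1)) x : P k ℓ x.1)
  map_add' f g := by simp
  map_smul' c f := by simp

theorem entry_apply (x y : Summand m) (f : NSYAlgebra k ℓ m) :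
    entry x y f = (toEnd k ℓ m f (Pi.single y (gen k ℓ y.1)) x : P k ℓ x.1) := rfl

theorem toEnd_apply (f : NSYAlgebra k ℓ m) (v : NSYModule k ℓ m) (x : Summand m) :
    (toEnd k ℓ m f v x : BoundCycle k n ℓ) = ∑ y, entry x y f * v y := by
  have hv : v = ∑ y, MulOpposite.op (v y : BoundCycle k n ℓ) •
      (Pi.single y (gen k ℓ y.1) : NSYModule k ℓ m) := by
    conv_lhs => rw [← Finset.univ_sum_single v]
    refine Finset.sum_congr rfl fun y _ => ?_
    rw [← Pi.single_smul]
    exact congrArg (Pi.single y) (Subtype.ext (e_mul_coe (v y)).symm)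
  conv_lhs => rw [hv]
  simp [map_sum, entry_apply]

theorem ext_entry {f g : NSYAlgebra k ℓ m} (h : ∀ x y, entry x y f = entry x y g) : f = g := by
  apply (toEnd k ℓ m).injective
  refine LinearMap.ext fun v => funext fun x => Subtype.ext ?_
  rw [toEnd_apply, toEnd_apply]
  simp only [h]

theorem e_mul_entry (f : NSYAlgebra k ℓ m) (x y : Summand m) :
    e k ℓ x.1 * entry x y f = entry x y f :=
  e_mul_coe _

theorem entry_mul_e (f : NSYAlgebra k ℓ m) (x y : Summand m) :
    entry x y f * e k ℓ y.1 = entry x y f := by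
  conv_rhs => rw [entry_apply, toEnd_apply]
  rw [Finset.sum_eq_single y (fun z _ hz => by simp [Pi.single_eq_of_ne hz]) (by simp),
    Pi.single_eq_same, gen]

theorem entry_mul (f g : NSYAlgebra k ℓ m) (x y : Summand m) :
    entry x y (f * g) = ∑ z, entry x z f * entry z y g := by
  rw [entry_apply, map_mul, Module.End.mul_apply, toEnd_apply]
  rfl

theorem entry_nsyX (x y : Summand m) (i : ZMod n) (j r s : ℕ) :
    entry x y (nsyX k ℓ m i j r s) =
      if (x.1 = i ∧ (x.2 : ℕ) = r) ∧ (y.1 = i + j ∧ (y.2 : ℕ) = s) then path k ℓ i j else 0 := by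
  rw [entry_apply, nsyX]
  split_ifs with h hxy hxy
  · obtain ⟨i, r⟩ := x
    obtain ⟨h, s⟩ := y
    obtain ⟨⟨rfl, rfl⟩, rfl, rfl⟩ := hxy
    simp only [AlgEquiv.apply_symm_apply, LinearMap.comp_apply, LinearMap.proj_apply,
      LinearMap.single_apply, Pi.single_eq_same]
    exact (path_mul_e _ _ _).trans (if_pos rfl)
  · rw [AlgEquiv.apply_symm_apply, LinearMap.comp_apply, LinearMap.comp_apply,
      LinearMap.proj_apply, LinearMap.single_apply]
    rcases not_and_or.1 hxy with hx | hy
    · rw [Pi.single_eq_of_ne (by rintro rfl; exact hx ⟨rfl, rfl⟩)]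
      rfl
    · have hne : (⟨i + j, s, h.2⟩ : Summand m) ≠ y := by
        rintro rfl
        exact hy ⟨rfl, rfl⟩
      rw [Pi.single_eq_of_ne hne, map_zero, Pi.single_zero]
      rfl
  · obtain ⟨⟨rfl, rfl⟩, hy, rfl⟩ := hxy
    exact absurd ⟨x.2.2, hy ▸ y.2.2⟩ h
  · simp

theorem nsyX_eq_zero (i : ZMod n) {j : ℕ} (r s : ℕ) (hj : ℓ ≤ j) : nsyX k ℓ m i j r s = 0 :=
  ext_entry fun x y => by rw [entry_nsyX, path_eq_zero i hj, ite_self, map_zero]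

theorem nsyX_mul_nsyX {i h : ZMod n} {j q r s r' s' : ℕ} (hs : s < m (i + j)) :
    nsyX k ℓ m i j r s * nsyX k ℓ m h q r' s' =
      if h = i + j ∧ r' = s then nsyX k ℓ m i (j + q) r s' else 0 := by
  refine ext_entry fun x y => ?_
  rw [entry_mul, Finset.sum_eq_single ⟨i + j, s, hs⟩]
  · simp only [entry_nsyX, apply_ite (entry x y), map_zero, ite_mul, mul_ite, zero_mul, mul_zero,
      path_mul_path, Nat.cast_add, ← add_assoc]
    grind
  · rintro ⟨a, t⟩ - hz
    rw [entry_nsyX, if_neg, zero_mul]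
    rintro ⟨-, rfl, rfl⟩
    exact hz rfl
  · simp

variable (m) in
/-- The coefficient of the element `X_{i,j}^{r,s}` with index `x`. -/
def coord (x : NSYIndex ℓ m) : NSYAlgebra k ℓ m →ₗ[k] k :=
  coeff x.1.1 ⟨x.1.2.1, x.2.1⟩ ∘ₗ
    entry ⟨x.1.1, x.1.2.2.1, x.2.2.1⟩ ⟨x.1.1 + (x.1.2.1 : ZMod n), x.1.2.2.2, x.2.2.2⟩

theorem coord_nsyX (x : NSYIndex ℓ m) (i : ZMod n) (j r s : ℕ) :
    coord m x (nsyX k ℓ m i j r s) = if x.1 = (i, j, r, s) then 1 else 0 := by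
  rw [coord, LinearMap.comp_apply, entry_nsyX, apply_ite (coeff _ _), coeff_path, map_zero]
  obtain ⟨⟨i', j', r', s'⟩, hx⟩ := x
  simp only [Prod.mk.injEq]
  grind

theorem ext_coord {f g : NSYAlgebra k ℓ m} (hfg : ∀ x, coord m x f = coord m x g) : f = g := by
  refine ext_entry fun x y => ext_coeff fun a j => ?_
  by_cases hxy : a = x.1 ∧ y.1 = a + (j : ℕ)
  · obtain ⟨i, r⟩ := x
    obtain ⟨h, s⟩ := y
    obtain ⟨rfl, rfl⟩ := hxy
    exact hfg ⟨(a, j, r, s), j.2, r.2, s.2⟩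
  · rw [coeff_eq_zero_of_mul (e_mul_entry f x y) (entry_mul_e f x y) hxy,
      coeff_eq_zero_of_mul (e_mul_entry g x y) (entry_mul_e g x y) hxy]

instance : Finite (NSYIndex ℓ m) :=
  .of_surjective
    (fun x : Σ y : ZMod n × Fin ℓ, Fin (m y.1) × Fin (m (y.1 + (y.2 : ℕ))) =>
      ⟨(x.1.1, x.1.2, x.2.1, x.2.2), x.1.2.2, x.2.1.2, x.2.2.2⟩)
    fun ⟨(i, j, r, s), hj, hr, hs⟩ => ⟨⟨(i, ⟨j, hj⟩), ⟨r, hr⟩, ⟨s, hs⟩⟩, rfl⟩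

variable (k ℓ m)

theorem dualBases_nsyX :
    Module.DualBases (fun x : NSYIndex ℓ m => nsyX k ℓ m x.1.1 x.1.2.1 x.1.2.2.1 x.1.2.2.2)
      (coord (k := k) m) where
  eval_same x := (coord_nsyX x _ _ _ _).trans (if_pos rfl)
  eval_of_ne x _ hxy := (coord_nsyX x _ _ _ _).trans (if_neg fun h => hxy (Subtype.ext h))
  total := ext_coord

/-- The basis of the elements `X_{i,j}^{r,s}`. -/
def basis : Module.Basis (NSYIndex ℓ m) k (NSYAlgebra k ℓ m) := (dualBases_nsyX k ℓ m).basis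

theorem coe_basis : ⇑(basis k ℓ m) =
    fun x : NSYIndex ℓ m => nsyX k ℓ m x.1.1 x.1.2.1 x.1.2.2.1 x.1.2.2.2 :=
  (dualBases_nsyX k ℓ m).coe_basis

/-! ### The comultiplication -/

/-- The coefficient `1 - δ_{m_a, m_{a-ℓ+1}} (1 - δ_{t,u})` in the comultiplication. -/
def weight (a : ZMod n) (t u : ℕ) : k :=
  1 - (if m a = m (a - ℓ + 1) then 1 else 0) * (1 - if t = u then 1 else 0)

/-- The `p`-th summand of the comultiplication at `X_{i,j}^{r,s}`. -/
def comulTerm (i : ZMod n) (j r s p : ℕ) : NSYAlgebra k ℓ m ⊗[k] NSYAlgebra k ℓ m :=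
  ∑ t ∈ Finset.range (m (i + j + p)), ∑ u ∈ Finset.range (m (i + j + p - ℓ + 1)),
    weight k ℓ m (i + j + p) t u •
      (nsyX k ℓ m i (j + p) r t ⊗ₜ[k] nsyX k ℓ m (i + j + p - ℓ + 1) (ℓ - 1 - p) u s)

/-- The value of the comultiplication at `X_{i,j}^{r,s}`. -/
def comulX (i : ZMod n) (j r s : ℕ) : NSYAlgebra k ℓ m ⊗[k] NSYAlgebra k ℓ m :=
  ∑ p ∈ Finset.range (ℓ - j), comulTerm k ℓ m i j r s p

variable {k ℓ m}

theorem comulTerm_eq_zero (i : ZMod n) {j p : ℕ} (r s : ℕ) (h : ℓ ≤ j + p) :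
    comulTerm k ℓ m i j r s p = 0 := by
  simp [comulTerm, nsyX_eq_zero _ _ _ h]

theorem comulX_eq_zero (i : ZMod n) {j : ℕ} (r s : ℕ) (h : ℓ ≤ j) : comulX k ℓ m i j r s = 0 := by
  rw [comulX, Nat.sub_eq_zero_of_le h, Finset.sum_range_zero]

theorem leftAct_comulTerm {i h : ZMod n} {j q r s r' s' : ℕ} (hs : s < m (i + j)) (p : ℕ) :
    leftAct (comulTerm k ℓ m h q r' s' p) (nsyX k ℓ m i j r s) =
      if h = i + j ∧ r' = s then comulTerm k ℓ m i (j + q) r s' p else 0 := by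
  rw [leftAct_apply]
  simp only [comulTerm, map_sum, map_smul, LinearMap.rTensor_tmul,
    LinearMap.mulLeft_apply, nsyX_mul_nsyX hs]
  split_ifs with hc
  · simp only [hc.1, Nat.cast_add, add_assoc]
  · simp only [TensorProduct.zero_tmul, smul_zero, Finset.sum_const_zero]

theorem rightAct_comulTerm {i h : ZMod n} {j q r s r' s' p : ℕ} (hs : s < m (i + j))
    (hp : p < ℓ) :
    rightAct (comulTerm k ℓ m i j r s p) (nsyX k ℓ m h q r' s') =
      if (h = i + j ∧ r' = s) ∧ q ≤ p then comulTerm k ℓ m i (j + q) r s' (p - q) else 0 := by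
  have hs' : s < m (i + j + p - ℓ + 1 + (ℓ - 1 - p : ℕ)) := by
    rwa [add_sub_add_one_add_cast _ hp]
  rw [rightAct_apply]
  simp only [comulTerm, map_sum, map_smul, LinearMap.lTensor_tmul,
    LinearMap.mulRight_apply, nsyX_mul_nsyX hs', add_sub_add_one_add_cast _ hp]
  by_cases hc : h = i + j ∧ r' = s
  · simp only [hc, and_self, true_and, if_true]
    by_cases hqp : q ≤ p
    · rw [if_pos hqp]
      obtain ⟨p, rfl⟩ := Nat.exists_eq_add_of_le hqp
      have hlength : ℓ - 1 - (q + p) + q = ℓ - 1 - p := by lia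
      simp only [hlength, Nat.add_sub_cancel_left, Nat.cast_add, add_assoc]
    · rw [if_neg hqp]
      simp only [nsyX_eq_zero _ _ _ (show ℓ ≤ ℓ - 1 - p + q by lia), TensorProduct.tmul_zero,
        smul_zero, Finset.sum_const_zero]
  · simp only [hc, false_and, if_false, TensorProduct.tmul_zero, smul_zero, Finset.sum_const_zero]

theorem leftAct_comulX {i h : ZMod n} {j q r s r' s' : ℕ} (hs : s < m (i + j)) :
    leftAct (comulX k ℓ m h q r' s') (nsyX k ℓ m i j r s) =
      if h = i + j ∧ r' = s then comulX k ℓ m i (j + q) r s' else 0 := by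
  simp only [comulX, map_sum, LinearMap.sum_apply, leftAct_comulTerm hs]
  split_ifs
  · refine (Finset.sum_subset (Finset.range_mono (by lia)) fun p _ hp => ?_).symm
    exact comulTerm_eq_zero _ _ _ (by grind)
  · exact Finset.sum_const_zero

theorem rightAct_comulX {i h : ZMod n} {j q r s r' s' : ℕ} (hs : s < m (i + j)) :
    rightAct (comulX k ℓ m i j r s) (nsyX k ℓ m h q r' s') =
      if h = i + j ∧ r' = s then comulX k ℓ m i (j + q) r s' else 0 := by
  have hterm : ∀ p ∈ Finset.range (ℓ - j),
      rightAct (comulTerm k ℓ m i j r s p) (nsyX k ℓ m h q r' s') =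
        if (h = i + j ∧ r' = s) ∧ q ≤ p then comulTerm k ℓ m i (j + q) r s' (p - q) else 0 :=
    fun p hp => rightAct_comulTerm hs (by grind)
  rw [comulX, map_sum, LinearMap.sum_apply, Finset.sum_congr rfl hterm]
  split_ifs with hc
  · simp only [hc, and_self, true_and]
    rw [comulX, ← Nat.sub_sub, ← Finset.sum_filter]
    have hIco : (Finset.range (ℓ - j)).filter (q ≤ ·) = Finset.Ico q (ℓ - j) := by grind
    simp only [hIco, Finset.sum_Ico_eq_sum_range, Nat.add_sub_cancel_left]
  · simp only [hc, false_and, if_false, Finset.sum_const_zero]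

variable (k ℓ m) in
/-- The comultiplication `Δ`. -/
def comul : NSYAlgebra k ℓ m →ₗ[k] NSYAlgebra k ℓ m ⊗[k] NSYAlgebra k ℓ m :=
  (basis k ℓ m).constr k fun x => comulX k ℓ m x.1.1 x.1.2.1 x.1.2.2.1 x.1.2.2.2

theorem comul_nsyX {i : ZMod n} {j r s : ℕ} (hr : r < m i) (hs : s < m (i + j)) :
    comul k ℓ m (nsyX k ℓ m i j r s) = comulX k ℓ m i j r s := by
  rcases lt_or_ge j ℓ with hj | hj
  · have hbasis := (basis k ℓ m).constr_basis k
      (fun x => comulX k ℓ m x.1.1 x.1.2.1 x.1.2.2.1 x.1.2.2.2) ⟨(i, j, r, s), hj, hr, hs⟩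
    rwa [coe_basis] at hbasis
  · rw [nsyX_eq_zero _ _ _ hj, comulX_eq_zero _ _ _ hj, map_zero]

theorem comul_nsyX_mul_nsyX {i h : ZMod n} {j q r s r' s' : ℕ} (hr : r < m i)
    (hs : s < m (i + j)) (hs' : s' < m (h + q)) :
    comul k ℓ m (nsyX k ℓ m i j r s * nsyX k ℓ m h q r' s') =
      if h = i + j ∧ r' = s then comulX k ℓ m i (j + q) r s' else 0 := by
  rw [nsyX_mul_nsyX hs]
  split_ifs with hc
  · obtain ⟨rfl, rfl⟩ := hc
    exact comul_nsyX hr (by rwa [Nat.cast_add, ← add_assoc])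
  · exact map_zero _

variable (k ℓ m) in
theorem isNonCounitalFrobenius_comul : IsNonCounitalFrobenius (comul k ℓ m) := by
  refine isNonCounitalFrobenius_of_basis (basis k ℓ m) ?_ ?_ <;>
    rw [coe_basis] <;>
    rintro ⟨⟨i, j, r, s⟩, -, hr, hs⟩ ⟨⟨h, q, r', s'⟩, -, hr', hs'⟩
  · rw [comul_nsyX_mul_nsyX hr hs hs', comul_nsyX hr' hs', leftAct_comulX hs]
  · rw [comul_nsyX_mul_nsyX hr hs hs', comul_nsyX hr hs, rightAct_comulX hs]

/-! ### The counit -/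

variable (k ℓ m) in
/-- The counit `ε` of the comultiplication, when there is one: the sum of the coefficients of the
elements `X_{i,ℓ-1}^{r,r}`. -/
def counit : NSYAlgebra k ℓ m →ₗ[k] k :=
  (basis k ℓ m).constr k fun x =>
    (if x.1.2.1 = ℓ - 1 then 1 else 0) * (if x.1.2.2.1 = x.1.2.2.2 then 1 else 0)

theorem counit_nsyX {i : ZMod n} {j r s : ℕ} (hj : j < ℓ) (hr : r < m i) (hs : s < m (i + j)) :
    counit k ℓ m (nsyX k ℓ m i j r s) =
      (if j = ℓ - 1 then 1 else 0) * (if r = s then 1 else 0) := by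
  have hbasis := (basis k ℓ m).constr_basis k
    (fun x => (if x.1.2.1 = ℓ - 1 then (1 : k) else 0) * (if x.1.2.2.1 = x.1.2.2.2 then 1 else 0))
    ⟨(i, j, r, s), hj, hr, hs⟩
  rwa [coe_basis] at hbasis

theorem comulTerm_of_multiplicity_eq (h : ∀ i, m i = m (i - ℓ + 1)) (i : ZMod n) (j r s p : ℕ) :
    comulTerm k ℓ m i j r s p = ∑ t ∈ Finset.range (m (i + j + p)),
      nsyX k ℓ m i (j + p) r t ⊗ₜ[k] nsyX k ℓ m (i + j + p - ℓ + 1) (ℓ - 1 - p) t s := by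
  refine Finset.sum_congr rfl fun t ht => ?_
  simp only [← h]
  have hweight (u : ℕ) : weight k ℓ m (i + j + p) t u = if t = u then 1 else 0 := by
    rw [weight, if_pos (h _), one_mul, sub_sub_cancel]
  simp only [hweight, ite_smul, one_smul, zero_smul, Finset.sum_ite_eq, if_pos ht]

theorem lid_counit_comulTerm (h : ∀ i, m i = m (i - ℓ + 1)) {i : ZMod n} {j r p : ℕ} (s : ℕ)
    (hr : r < m i) (hp : j + p < ℓ) :
    TensorProduct.lid k _ ((counit k ℓ m).rTensor _ (comulTerm k ℓ m i j r s p)) =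
      if p = ℓ - 1 - j then nsyX k ℓ m i j r s else 0 := by
  have hcounit : ∀ t ∈ Finset.range (m (i + j + p)), counit k ℓ m (nsyX k ℓ m i (j + p) r t) =
      (if j + p = ℓ - 1 then 1 else 0) * (if r = t then 1 else 0) := fun t ht =>
    counit_nsyX hp hr (by simpa [add_assoc] using ht)
  simp only [comulTerm_of_multiplicity_eq h, map_sum, LinearMap.rTensor_tmul,
    TensorProduct.lid_tmul]
  rw [Finset.sum_congr rfl fun t ht => by rw [hcounit t ht]]
  by_cases hpj : p = ℓ - 1 - j
  · have hi : i + j + p - ℓ + 1 = i := by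
      have hℓ : ((j + p + 1 : ℕ) : ZMod n) = ℓ := congrArg _ (by lia)
      rw [← hℓ]
      push_cast
      ring
    have hj : ℓ - 1 - p = j := by lia
    have hrm : r < m (i + j + p) := by rwa [h, hi]
    simp [if_pos hpj, show j + p = ℓ - 1 by lia, hi, hj, hrm]
  · simp [if_neg hpj, show j + p ≠ ℓ - 1 by lia]

theorem rid_counit_comulTerm (h : ∀ i, m i = m (i - ℓ + 1)) {i : ZMod n} {j s p : ℕ} (r : ℕ)
    (hs : s < m (i + j)) (hp : p < ℓ) :
    TensorProduct.rid k _ ((counit k ℓ m).lTensor _ (comulTerm k ℓ m i j r s p)) =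
      if p = 0 then nsyX k ℓ m i j r s else 0 := by
  have hcounit : ∀ t ∈ Finset.range (m (i + j + p)),
      counit k ℓ m (nsyX k ℓ m (i + j + p - ℓ + 1) (ℓ - 1 - p) t s) =
        (if ℓ - 1 - p = ℓ - 1 then 1 else 0) * (if t = s then 1 else 0) := fun t ht =>
    counit_nsyX (by lia) (by rwa [← h, ← Finset.mem_range])
      (by rwa [add_sub_add_one_add_cast _ hp])
  simp only [comulTerm_of_multiplicity_eq h, map_sum, LinearMap.lTensor_tmul,
    TensorProduct.rid_tmul]
  rw [Finset.sum_congr rfl fun t ht => by rw [hcounit t ht]]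
  by_cases hp₀ : p = 0
  · simp [hp₀, hs]
  · simp [hp₀, show ℓ - 1 - p ≠ ℓ - 1 by lia]

variable (k) in
theorem isCounitOf_counit (h : ∀ i, m i = m (i - ℓ + 1)) :
    IsCounitOf (comul k ℓ m) (counit k ℓ m) := by
  constructor <;> refine (basis k ℓ m).ext ?_ <;> rw [coe_basis] <;>
    rintro ⟨⟨i, j, r, s⟩, hj, hr, hs⟩
  · change TensorProduct.lid k _ ((counit k ℓ m).rTensor _ (comul k ℓ m _)) = _
    rw [comul_nsyX hr hs, comulX, map_sum, map_sum,
      Finset.sum_congr rfl fun p hp => lid_counit_comulTerm h s hr (by grind)]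
    exact (Finset.sum_ite_eq' _ _ _).trans (if_pos (by grind))
  · change TensorProduct.rid k _ ((counit k ℓ m).lTensor _ (comul k ℓ m _)) = _
    rw [comul_nsyX hr hs, comulX, map_sum, map_sum,
      Finset.sum_congr rfl fun p hp => rid_counit_comulTerm h r hs (by grind)]
    exact (Finset.sum_ite_eq' _ _ _).trans (if_pos (by grind))

/-! ### The multiplicities of a Frobenius algebra -/

theorem multiplicity_le_of_isFrobeniusAlgebra (hℓ : 1 ≤ ℓ)
    (hA : IsFrobeniusAlgebra k (NSYAlgebra k ℓ m)) (i : ZMod n) (hi : 0 < m i) :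
    m (i + (ℓ - 1 : ℕ)) ≤ m i := by
  -- The elements `X_{i,ℓ-1}^{0,s}` are killed on the left by every basis element except the
  -- `X_{i,0}^{r,0}`.
  let socle (s : Fin (m (i + (ℓ - 1 : ℕ)))) : NSYIndex ℓ m :=
    ⟨(i, ℓ - 1, 0, s), Nat.sub_lt hℓ one_pos, hi, s.2⟩
  have hsocle : Function.Injective socle := fun s t hst => Fin.ext (by simpa [socle] using hst)
  have hcard := hA.card_le_of_mul_eq_zero ((basis k ℓ m).linearIndependent.comp socle hsocle)
    (y := fun r : Fin (m i) => nsyX k ℓ m i 0 r 0) (basis k ℓ m).span_eq ?_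
  · simpa using hcard
  rw [coe_basis]
  rintro _ ⟨⟨⟨h, q, r, t⟩, -, hr, ht⟩, rfl⟩
  by_cases hc : h = i ∧ q = 0 ∧ t = 0
  · obtain ⟨rfl, rfl, rfl⟩ := hc
    exact .inl ⟨⟨r, hr⟩, rfl⟩
  · refine .inr fun s => (nsyX_mul_nsyX ht).trans ?_
    rw [ite_eq_right_iff]
    rintro ⟨hiq, rfl⟩
    refine nsyX_eq_zero _ _ _ ?_
    have hq : q ≠ 0 := by
      rintro rfl
      exact hc ⟨by simpa using hiq.symm, rfl, rfl⟩
    lia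

theorem multiplicity_eq_of_isFrobeniusAlgebra (hℓ : 1 ≤ ℓ) (hm : ∀ i, 0 < m i)
    (hA : IsFrobeniusAlgebra k (NSYAlgebra k ℓ m)) (i : ZMod n) : m i = m (i - ℓ + 1) := by
  have hsum : ∑ i, m (i + (ℓ - 1 : ℕ)) = ∑ i, m i :=
    Equiv.sum_comp (Equiv.addRight ((ℓ - 1 : ℕ) : ZMod n)) m
  have hle (i : ZMod n) : m (i + (ℓ - 1 : ℕ)) ≤ m i :=
    multiplicity_le_of_isFrobeniusAlgebra hℓ hA i (hm i)
  have heq := (Finset.sum_eq_sum_iff_of_le fun i _ => hle i).1 hsum (i - ℓ + 1) (Finset.mem_univ _)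
  have hi : i - ℓ + 1 + (ℓ - 1 : ℕ) = i := by simpa using add_sub_add_one_add_cast (p := 0) i hℓ
  rwa [hi] at heq

end NSYAlgebra

end

theorem theorem2p7 (k : Type*) [Field k] (n ℓ : ℕ) [NeZero n] (hℓ : 1 ≤ ℓ)
    (m : ZMod n → ℕ) (hm : ∀ i, 0 < m i) :
    -- the elements `X_{i,j}^{r,s}` form a basis
    (LinearIndependent k (fun x : NSYIndex ℓ m =>
        nsyX k ℓ m x.1.1 x.1.2.1 x.1.2.2.1 x.1.2.2.2) ∧
      Submodule.span k (Set.range (fun x : NSYIndex ℓ m =>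
        nsyX k ℓ m x.1.1 x.1.2.1 x.1.2.2.1 x.1.2.2.2)) = ⊤) ∧
    ∃ Δ : NSYAlgebra k ℓ m →ₗ[k] NSYAlgebra k ℓ m ⊗[k] NSYAlgebra k ℓ m,
      -- the formula for the comultiplication
      (∀ (i : ZMod n) (j r s : ℕ), j < ℓ → r < m i → s < m (i + j) →
        Δ (nsyX k ℓ m i j r s) =
          ∑ p ∈ Finset.range (ℓ - j), ∑ t ∈ Finset.range (m (i + j + p)),
            ∑ u ∈ Finset.range (m (i + j + p - ℓ + 1)),
              (1 - (if m (i + j + p) = m (i + j + p - ℓ + 1) then (1 : k) else 0) *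
                  (1 - (if t = u then (1 : k) else 0))) •
                (nsyX k ℓ m i (j + p) r t ⊗ₜ[k]
                  nsyX k ℓ m (i + j + p - ℓ + 1) (ℓ - 1 - p) u s)) ∧
      IsNonCounitalFrobenius Δ ∧
      -- when the algebra is Frobenius, and when this comultiplication makes it so
      (IsFrobeniusAlgebra k (NSYAlgebra k ℓ m) ↔ ∀ i, m i = m (i - ℓ + 1)) ∧
      ((∃ ε : NSYAlgebra k ℓ m →ₗ[k] k, IsCounitOf Δ ε) ↔ ∀ i, m i = m (i - ℓ + 1)) ∧
      -- the formula for the counit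
      ((∀ i, m i = m (i - ℓ + 1)) →
        ∃ ε : NSYAlgebra k ℓ m →ₗ[k] k,
          (∀ (i : ZMod n) (j r s : ℕ), j < ℓ → r < m i → s < m (i + j) →
            ε (nsyX k ℓ m i j r s) =
              (if j = ℓ - 1 then 1 else 0) * (if r = s then 1 else 0)) ∧
          IsCounitOf Δ ε) := by
  have hΔ := NSYAlgebra.isNonCounitalFrobenius_comul k ℓ m
  have hε := NSYAlgebra.isCounitOf_counit k (ℓ := ℓ) (m := m)
  have hmult := NSYAlgebra.multiplicity_eq_of_isFrobeniusAlgebra (k := k) hℓ hm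
  rw [← NSYAlgebra.coe_basis k ℓ m]
  refine ⟨⟨(NSYAlgebra.basis k ℓ m).linearIndependent, (NSYAlgebra.basis k ℓ m).span_eq⟩,
    NSYAlgebra.comul k ℓ m, ?_, hΔ, ⟨hmult, ?_⟩, ⟨?_, ?_⟩, ?_⟩
  · exact fun i j r s _ hr hs => NSYAlgebra.comul_nsyX hr hs
  · exact fun h => ⟨_, _, hΔ, hε h⟩
  · exact fun ⟨ε, hε⟩ => hmult ⟨_, ε, hΔ, hε⟩
  · exact fun h => ⟨_, hε h⟩
  · exact fun h => ⟨_, fun i j r s hj hr hs => NSYAlgebra.counit_nsyX hj hr hs, hε h⟩
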